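/- Let $X$ be a non-empty regular $T_1$ topological space. **Definitions.** For families $\mathcal A,\mathcal B$ of sets, in the game $\mathsf G_1(\mathcal A,\mathcal B)$, at each inning $n\in\omega$ player One chooses $A_n\in\mathcal A$ and Two answers with some $x_n\in A_n$; Two wins if $\{x_n:n\in\omega\}\in\mathcal B$. A *winning Markov strategy* for Two is a function $\tau$ on $\mathcal A\times\omega$ with $\tau(A,n)\in A$ for all $A \in \mathcal A$, $n \in \omega$, such that $\{\tau(A_n,n):n\in\omega\}\in\mathcal B$ for every sequence $(A_n)_{n\in\omega}$ in $\mathcal A$; its existence is written $\mathrm{II}\underset{\mathrm{mark}}{\uparrow}\mathsf G_1(\mathcal A,\mathcal B)$. An open cover $\mathscr U$ of $X$ is *non-trivial* if $\emptyset\notin\mathscr U$ and $X\notin\mathscr U$. $\Omega_X$ (respectively $\mathcal K_X$) is the set of non-trivial open covers $\mathscr U$ of $X$ such that every non-empty finite (respectively compact) subset of $X$ is contained in a member of $\mathscr U$. For a space $Z$ and $z\in Z$, $\Omega_{Z,z}=\{A\subseteq Z: z\in\mathrm{cl}(A)\}$, and $\mathscr D_Z$ is the set of dense subsets of $Z$.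 $Z$ is *discretely selective* if for every sequence $(U_n)_{n\in\omega}$ of proper non-empty open subsets of $Z$ there are $z_n\in U_n$ such that $\{z_n:n\in\omega\}$ is closed and discrete. $Z$ is *hemicompact* if there are compact sets $K_n\subseteq Z$ ($n\in\omega$) such that every compact subset of $Z$ is contained in some $K_n$. $\mathbb K(X)$ is the set of non-empty compact subsets of $X$ with the Vietoris topology. An *usco map* $\Phi:X\to\mathbb K(\mathbb R)$ assigns to each $x\in X$ a non-empty compact set $\Phi(x)\subseteq\mathbb R$ so that $\{x:\Phi(x)\subseteq V\}$ is open for every open $V\subseteq\mathbb R$; it is *minimal* if its graph is minimal under inclusion among the graphs of usco maps. $MU(X)$ is the set of minimal usco maps $X\to\mathbb K(\mathbb R)$. $MU_p(X)$ and $MU_k(X)$ are $MU(X)$ with the topology of the uniformity with base the sets $$\mathbf W(A,\varepsilon)=\{\langle\Phi,\Psi\rangle:(\forall x\in A)\ \Phi(x)\subseteq\mathbb B(\Psi(x),\varepsilon)\wedge\Psi(x)\subseteq\mathbb B(\Phi(x),\varepsilon)\},\quad \varepsilon>0,$$ where $A$ runs over the non-empty finite, respectively the non-empty compact, subsets of $X$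 and $\mathbb B(Y,\varepsilon)=\bigcup_{y\in Y}(y-\varepsilon,y+\varepsilon)$. $\mathbf 0$ is the map that is constantly $\{0\}$. **Corollary 3.10.** The following are equivalent. 1. $X$ is countable. 2. $MU_p(X)$ is metrizable. 3. $MU_p(X)$ is not discretely selective. 4. $\mathrm{II}\underset{\mathrm{mark}}{\uparrow}\mathsf G_1(\Omega_X,\Omega_X)$. 5. $\mathrm{II}\underset{\mathrm{mark}}{\uparrow}\mathsf G_1(\Omega_{MU_p(X),\mathbf 0},\Omega_{MU_p(X),\mathbf 0})$. 6. $\mathrm{II}\underset{\mathrm{mark}}{\uparrow}\mathsf G_1(\mathscr D_{MU_p(X)},\Omega_{MU_p(X),\mathbf 0})$. Also, the following are equivalent. 1. $X$ is hemicompact. 2. $\mathbb K(X)$ is hemicompact. 3. $MU_k(X)$ is metrizable. 4. $MU_k(X)$ is not discretely selective. 5. $\mathrm{II}\underset{\mathrm{mark}}{\uparrow}\mathsf G_1(\mathcal K_X,\mathcal K_X)$. 6. $\mathrm{II}\underset{\mathrm{mark}}{\uparrow}\mathsf G_1(\Omega_{MU_k(X),\mathbf 0},\Omega_{MU_k(X),\mathbf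 0})$. 7. $\mathrm{II}\underset{\mathrm{mark}}{\uparrow}\mathsf G_1(\mathscr D_{MU_k(X)},\Omega_{MU_k(X),\mathbf 0})$. -/

import Mathlib

open Set Topology TopologicalSpace Uniformity

namespace MinimalUsco

/-! ### Single-selection games -/

section Games

variable {α : Type*}

/-- Two has a winning Markov strategy in `G₁(𝒜, ℬ)`: a rule `τ` which, from One's most recent move
`A ∈ 𝒜` and the turn number `n` only, gives a legal answer `τ A n ∈ A`, such that against every
sequence `A₀, A₁, …` of moves of One the set `{τ Aₙ n : n ∈ ω}` belongs to `ℬ`. -/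
def TwoMarkovWins (𝒜 ℬ : Set (Set α)) : Prop :=
  ∃ τ : 𝒜 → ℕ → α, (∀ (A : 𝒜) (n : ℕ), τ A n ∈ (A : Set α)) ∧
    ∀ A : ℕ → 𝒜, range (fun n => τ (A n) n) ∈ ℬ

/-- The single-selection principle `S₁(𝒜, ℬ)`. -/
def SelectionPrinciple (𝒜 ℬ : Set (Set α)) : Prop :=
  ∀ A : ℕ → Set α, (∀ n, A n ∈ 𝒜) → ∃ x : ℕ → α, (∀ n, x n ∈ A n) ∧ range x ∈ ℬ

end Games

/-! ### Classes of subsets and of covers of a space -/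

section Classes

variable (X : Type*) [TopologicalSpace X]

/-- The non-empty finite subsets of `X`. -/
def finiteSets : Set (Set X) := {A | A.Finite ∧ A.Nonempty}

/-- The non-empty compact subsets of `X`. -/
def compactSets : Set (Set X) := {A | IsCompact A ∧ A.Nonempty}

/-- The proper non-empty open subsets of `X`. -/
def properOpens : Set (Set X) := {U | IsOpen U ∧ U.Nonempty ∧ U ≠ univ}

/-- The closed discrete subsets of `X`. -/
def closedDiscrete : Set (Set X) := {D | IsClosed D ∧ IsDiscrete D}

/-- The dense subsets of `X`. -/
def denseSets : Set (Set X) := {D | Dense D}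

variable {X} in
/-- The sets that cluster at `x`, that is, `Ω_{X,x}`. -/
def clusterSets (x : X) : Set (Set X) := {A | x ∈ closure A}

variable {X} in
/-- The non-trivial open covers `𝒰` of `X` such that every member of `𝒜` is contained in a member
of `𝒰`; non-trivial means that neither `∅` nor `X` belongs to `𝒰`. -/
def coversOf (𝒜 : Set (Set X)) : Set (Set (Set X)) :=
  {𝒰 | (∀ U ∈ 𝒰, IsOpen U) ∧ ⋃₀ 𝒰 = univ ∧ ∅ ∉ 𝒰 ∧ univ ∉ 𝒰 ∧ ∀ A ∈ 𝒜, ∃ U ∈ 𝒰, A ⊆ U}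

/-- The `ω`-covers of `X`. -/
def omegaCovers : Set (Set (Set X)) := coversOf (finiteSets X)

/-- The `k`-covers of `X`. -/
def kCovers : Set (Set (Set X)) := coversOf (compactSets X)

/-- `X` is discretely selective: `S₁` of the proper non-empty open sets and the closed discrete
sets. -/
def DiscretelySelective : Prop := SelectionPrinciple (properOpens X) (closedDiscrete X)

/-- `X` is hemicompact: countably many compact sets are cofinal among the compact subsets. -/
def Hemicompact : Prop :=
  ∃ K : ℕ → Set X, (∀ n, IsCompact (K n)) ∧ ∀ C : Set X, IsCompact C → ∃ n, C ⊆ K n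

end Classes

/-! ### Minimal usco maps -/

section Usco

variable {X Y : Type*} [TopologicalSpace X] [TopologicalSpace Y]

/-- A map into the non-empty compact subsets of `Y` is usco if it is upper semicontinuous. -/
def IsUsco (Φ : X → NonemptyCompacts Y) : Prop :=
  ∀ V : Set Y, IsOpen V → IsOpen {x | (Φ x : Set Y) ⊆ V}

/-- A minimal usco map: the order on `X → NonemptyCompacts Y` is pointwise inclusion, that is,
inclusion of graphs. -/
def IsMinimalUsco (Φ : X → NonemptyCompacts Y) : Prop := Minimal IsUsco Φ

theorem isMinimalUsco_const_singleton (y : Y) :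
    IsMinimalUsco (fun _ : X => ({y} : NonemptyCompacts Y)) := by
  refine ⟨fun V _ => isOpen_const, fun Ψ _ hle x => ?_⟩
  have h1 : (Ψ x : Set Y) ⊆ {y} := by
    simpa using (SetLike.coe_subset_coe.mpr (hle x) : (Ψ x : Set Y) ⊆ _)
  have h2 : (Ψ x : Set Y) = {y} := (Ψ x).nonempty.subset_singleton_iff.mp h1
  have h3 : Ψ x = {y} := SetLike.coe_injective (by simpa using h2)
  exact h3.ge

end Usco

/-- The set of minimal usco maps from `X` to `ℝ`, to be given the topology of uniform convergence
on the members of `𝒜`. -/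
def MU (X : Type*) [TopologicalSpace X] (𝒜 : Set (Set X)) : Type _ :=
  {Φ : X → NonemptyCompacts ℝ // IsMinimalUsco Φ}

section MU

variable {X : Type*} [TopologicalSpace X] {𝒜 : Set (Set X)}

/-- The uniformity of uniform convergence on the members of `𝒜`, where `NonemptyCompacts ℝ` carries
the Hausdorff uniformity. -/
instance : UniformSpace (MU X 𝒜) :=
  UniformSpace.comap (fun Φ : MU X 𝒜 => UniformOnFun.ofFun 𝒜 Φ.1) inferInstance

/-- The map that is constantly `{0}`. -/
instance : Zero (MU X 𝒜) := ⟨⟨fun _ => {0}, isMinimalUsco_const_singleton 0⟩⟩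

/-- The basic entourages
`W(A, ε) = {(Φ, Ψ) : ∀ x ∈ A, Φ(x) ⊆ B(Ψ(x), ε) and Ψ(x) ⊆ B(Φ(x), ε)}`. -/
def W (𝒜 : Set (Set X)) (A : Set X) (ε : ℝ) : Set (MU X 𝒜 × MU X 𝒜) :=
  {p | ∀ x ∈ A, (p.1.1 x : Set ℝ) ⊆ Metric.thickening ε (p.2.1 x : Set ℝ) ∧
    (p.2.1 x : Set ℝ) ⊆ Metric.thickening ε (p.1.1 x : Set ℝ)}

/-- For a non-empty directed family `𝒜`, the sets `W(A, ε)` are a base for the uniformity. -/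
theorem hasBasis_uniformity (h : 𝒜.Nonempty) (h' : DirectedOn (· ⊆ ·) 𝒜) :
    (𝓤 (MU X 𝒜)).HasBasis (fun p : Set X × ℝ => p.1 ∈ 𝒜 ∧ 0 < p.2) (fun p => W 𝒜 p.1 p.2) := by
  have hb := (UniformOnFun.hasBasis_uniformity_of_basis X (NonemptyCompacts ℝ) 𝒜 h h'
    (Metric.uniformity_basis_dist (α := ℝ)).uniformity_nonemptyCompacts).comap
    (fun p : MU X 𝒜 × MU X 𝒜 => (UniformOnFun.ofFun 𝒜 p.1.1, UniformOnFun.ofFun 𝒜 p.2.1))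
  refine hb.congr (fun _ => Iff.rfl) (fun p _ => ?_)
  ext q
  refine forall₂_congr fun x _ => and_congr ?_ ?_
  · refine forall₂_congr fun y _ => ?_
    simp [Metric.mem_thickening_iff, SetRel.mem_preimage]
  · refine forall₂_congr fun y _ => ?_
    simp [Metric.mem_thickening_iff, SetRel.mem_image, dist_comm]

end MU

/-- `MU_p(X)`: the minimal usco maps with uniform convergence on finite sets. -/
abbrev MUp (X : Type*) [TopologicalSpace X] : Type _ := MU X (finiteSets X)

/-- `MU_k(X)`: the minimal usco maps with uniform convergence on compact sets. -/
abbrev MUk (X : Type*) [TopologicalSpace X] : Type _ := MU X (compactSets X)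

end MinimalUsco

open MinimalUsco

/-! Both lists are instances of `MU.tfae`, for a directed family `𝒜` of compact sets containing the
finite ones; everything is equivalent to `𝒜` having a cofinal sequence. Given such a sequence, the
uniformity is countably generated, hence metrizable. First countability at the non-isolated point
`0` then refutes discrete selectivity and lets Two play a sequence converging to `0`. In the cover
game Two covers the `n`-th cofinal set. Without one, any sequence in `𝒜` is escaped by a single `C ∈
𝒜`, with points `x n ∈ C` off the `n`-th set. A minimal usco map can be changed at `x n` without
leaving a basic neighbourhood that controls only the `n`-th set. Hence non-empty open sets `U n`
contain maps with prescribed values `{r n}` on `C`: values `n` give a closed discrete selection,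
values `1` keep Two's answers away from `0`. -/

namespace MinimalUsco

/-! ### Existence and modification of minimal usco maps -/

section Usco

variable {X Y : Type*} [TopologicalSpace X] [TopologicalSpace Y]

/-- The pointwise intersection of a non-empty chain of usco maps is a lower bound which is usco. -/
theorem exists_isUsco_lowerBound_of_isChain [T2Space Y] {c : Set (X → NonemptyCompacts Y)}
    (hc : IsChain (· ≤ ·) c) (hne : c.Nonempty) (hu : ∀ Φ ∈ c, IsUsco Φ) :
    ∃ Φ, IsUsco Φ ∧ ∀ Ψ ∈ c, Φ ≤ Ψ := by
  have : Nonempty c := hne.to_subtype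
  have hdir : ∀ x, Directed (· ⊇ ·) fun Φ : c => (Φ.1 x : Set Y) := by
    intro x Φ Ψ
    rcases hc.total Φ.2 Ψ.2 with h | h
    · exact ⟨Φ, Subset.rfl, SetLike.coe_subset_coe.mpr (h x)⟩
    · exact ⟨Ψ, SetLike.coe_subset_coe.mpr (h x), Subset.rfl⟩
  have hcpt : ∀ x, ∀ Φ : c, IsCompact (Φ.1 x : Set Y) := fun x Φ => (Φ.1 x).isCompact
  let Θ : X → NonemptyCompacts Y := fun x =>
    { carrier := ⋂ Φ : c, (Φ.1 x : Set Y)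
      isCompact' := (hcpt x (Classical.arbitrary c)).of_isClosed_subset
        (isClosed_iInter fun Φ => (hcpt x Φ).isClosed) (iInter_subset _ _)
      nonempty' := IsCompact.nonempty_iInter_of_directed_nonempty_isCompact_isClosed _ (hdir x)
        (fun Φ => (Φ.1 x).nonempty) (hcpt x) fun Φ => (hcpt x Φ).isClosed }
  have hΘ : ∀ Ψ ∈ c, ∀ x, (Θ x : Set Y) ⊆ Ψ x := fun Ψ hΨ x =>
    iInter_subset (fun Φ : c => (Φ.1 x : Set Y)) ⟨Ψ, hΨ⟩
  refine ⟨Θ, fun V hV => isOpen_iff_mem_nhds.mpr fun x hx => ?_, fun Ψ hΨ x => hΘ Ψ hΨ x⟩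
  obtain ⟨Φ, hΦ⟩ := exists_subset_nhds_of_isCompact (hdir x) (hcpt x)
    (U := V) fun y hy => hV.mem_nhds (hx hy)
  exact Filter.mem_of_superset ((hu Φ.1 Φ.2 V hV).mem_nhds hΦ)
    fun y hy => (hΘ Φ.1 Φ.2 y).trans hy

/-- Every usco map into a Hausdorff space contains a minimal one. -/
theorem IsUsco.exists_isMinimalUsco_le [T2Space Y] {Φ : X → NonemptyCompacts Y} (h : IsUsco Φ) :
    ∃ Ψ, IsMinimalUsco Ψ ∧ Ψ ≤ Φ := by
  obtain ⟨Ψ, hle, hmin⟩ := zorn_le_nonempty₀ (α := (X → NonemptyCompacts Y)ᵒᵈ)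
    {Ψ | IsUsco (OrderDual.ofDual Ψ)}
    (fun c hcs hc Ψ hΨ => exists_isUsco_lowerBound_of_isChain hc.symm ⟨Ψ, hΨ⟩ hcs)
    (OrderDual.toDual Φ) h
  exact ⟨OrderDual.ofDual Ψ, ⟨hmin.1, fun Θ hΘ hl => hmin.2 (y := OrderDual.toDual Θ) hΘ hl⟩, hle⟩

/-- A minimal usco map is minimal on every open set. -/
theorem IsMinimalUsco.eqOn_of_isOpen {Φ Ψ : X → NonemptyCompacts Y} (hΦ : IsMinimalUsco Φ)
    (hΨ : IsUsco Ψ) {U : Set X} (hU : IsOpen U) (hle : ∀ x ∈ U, Ψ x ≤ Φ x) : EqOn Ψ Φ U := by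
  classical
  have hle' : U.piecewise Ψ Φ ≤ Φ := by
    intro x
    by_cases hx : x ∈ U
    · simpa [hx] using hle x hx
    · simp [hx]
  have husco : IsUsco (U.piecewise Ψ Φ) := by
    intro V hV
    convert (hU.inter (hΨ V hV)).union (hΦ.1 V hV) using 1
    ext x
    by_cases hx : x ∈ U
    · simp only [mem_ofPred_eq, piecewise_eq_of_mem _ _ _ hx, mem_union, mem_inter_iff, hx, true_and]
      exact ⟨Or.inl, fun h => h.elim id (SetLike.coe_subset_coe.mpr (hle x hx)).trans⟩
    · simp [hx]
  intro x hx
  have := hΦ.2 husco hle' x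
  rw [piecewise_eq_of_mem _ _ _ hx] at this
  exact le_antisymm (hle x hx) this

/-- Off a compact set, a minimal usco map can be given any prescribed value at any point. -/
theorem IsMinimalUsco.exists_eqOn_apply_eq [T3Space X] [T2Space Y] {Φ : X → NonemptyCompacts Y}
    (hΦ : IsMinimalUsco Φ) {A : Set X} (hA : IsCompact A) {x : X} (hx : x ∉ A) (y : Y) :
    ∃ Ψ, IsMinimalUsco Ψ ∧ EqOn Ψ Φ A ∧ Ψ x = {y} := by
  classical
  obtain ⟨F, hF, hFc, hFA⟩ := exists_mem_nhds_isClosed_subset (hA.isClosed.isOpen_compl.mem_nhds hx)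
  -- Adding `y` on the boundary of `F` preserves upper semicontinuity. A minimal map below `Θ` is
  -- forced to be `{y}` at `x`, and off `F` it agrees with `Φ` by minimality of `Φ`.
  let Θ : X → NonemptyCompacts Y := fun z =>
    if z ∈ interior F then {y} else if z ∈ F then Φ z ⊔ {y} else Φ z
  have hΘ : IsUsco Θ := by
    intro V hV
    by_cases hy : y ∈ V
    · convert (isOpen_interior (s := F)).union (hΦ.1 V hV) using 1
      ext z
      by_cases h1 : z ∈ interior F
      · simp [Θ, h1, hy]
      · by_cases h2 : z ∈ F
        · simp [Θ, h1, h2, hy, insert_subset_iff]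
        · simp [Θ, h1, h2]
    · convert hFc.isOpen_compl.inter (hΦ.1 V hV) using 1
      ext z
      by_cases h1 : z ∈ interior F
      · simp [Θ, h1, hy, interior_subset h1]
      · by_cases h2 : z ∈ F
        · simp [Θ, h1, h2, hy, insert_subset_iff]
        · simp [Θ, h1, h2]
  obtain ⟨Ψ, hΨ, hle⟩ := hΘ.exists_isMinimalUsco_le
  refine ⟨Ψ, hΨ, ?_, ?_⟩
  · refine (hΦ.eqOn_of_isOpen hΨ.1 hFc.isOpen_compl fun z hz => (hle z).trans ?_).mono
      (subset_compl_comm.mp hFA)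
    have h1 : z ∉ interior F := fun h => hz (interior_subset h)
    simp [Θ, h1, show z ∉ F from hz]
  · have hxF : x ∈ interior F := mem_interior_iff_mem_nhds.mpr hF
    have := hle x
    simp only [Θ, hxF, if_true] at this
    exact NonemptyCompacts.ext
      ((Ψ x).nonempty.subset_singleton_iff.mp (by simpa using SetLike.coe_subset_coe.mpr this))

/-- A real usco map is bounded on every compact set. -/
theorem IsUsco.exists_forall_subset_ball {Φ : X → NonemptyCompacts ℝ} (h : IsUsco Φ) {C : Set X}
    (hC : IsCompact C) : ∃ n : ℕ, ∀ x ∈ C, (Φ x : Set ℝ) ⊆ Metric.ball 0 n := by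
  refine hC.elim_directed_cover (fun n : ℕ => {x | (Φ x : Set ℝ) ⊆ Metric.ball 0 n})
    (fun n => h _ Metric.isOpen_ball) (fun x _ => ?_) (directed_of_isDirected_le fun m n hmn x hx =>
      hx.trans (Metric.ball_subset_ball (by exact_mod_cast hmn)))
  obtain ⟨r, hr⟩ := (Φ x).isCompact.isBounded.subset_ball 0
  obtain ⟨n, hn⟩ := exists_nat_ge r
  exact mem_iUnion.mpr ⟨n, hr.trans (Metric.ball_subset_ball hn)⟩

end Usco

/-! ### Cofinal sequences and the space of minimal usco maps -/

section Cofinal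

variable {X : Type*}

/-- The family `𝒜` has a sequence of members which is cofinal with respect to inclusion. -/
def HasCofinalSeq (𝒜 : Set (Set X)) : Prop :=
  ∃ A : ℕ → Set X, (∀ n, A n ∈ 𝒜) ∧ ∀ B ∈ 𝒜, ∃ n, B ⊆ A n

/-- If `𝒜` has no cofinal sequence, then for every sequence in `𝒜` some member of `𝒜` has points
outside each of its terms. -/
theorem exists_mem_forall_notMem_of_not_hasCofinalSeq {𝒜 : Set (Set X)} (h : ¬ HasCofinalSeq 𝒜)
    {A : ℕ → Set X} (hA : ∀ n, A n ∈ 𝒜) :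
    ∃ C ∈ 𝒜, ∃ x : ℕ → X, ∀ n, x n ∈ C ∧ x n ∉ A n := by
  by_contra! hcon
  refine h ⟨A, hA, fun B hB => ?_⟩
  by_contra! hB'
  choose x hx using fun n => not_subset.mp (hB' n)
  obtain ⟨n, hn⟩ := hcon B hB x
  exact (hx n).2 (hn (hx n).1)

theorem hasCofinalSeq_finiteSets_iff [TopologicalSpace X] [Nonempty X] :
    HasCofinalSeq (finiteSets X) ↔ Countable X := by
  constructor
  · rintro ⟨A, hA, hcof⟩
    refine countable_univ_iff.mp ((countable_iUnion fun n => (hA n).1.countable).mono fun x _ => ?_)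
    obtain ⟨n, hn⟩ := hcof {x} ⟨finite_singleton x, singleton_nonempty x⟩
    exact mem_iUnion.mpr ⟨n, hn rfl⟩
  · intro _
    obtain ⟨e, he⟩ := exists_surjective_nat X
    refine ⟨fun n => e '' Iic n, fun n => ⟨(finite_Iic n).image e, nonempty_Iic.image e⟩,
      fun B hB => ?_⟩
    choose g hg using he
    obtain ⟨n, hn⟩ := (hB.1.image g).bddAbove
    exact ⟨n, fun x hx => ⟨g x, hn (mem_image_of_mem g hx), hg x⟩⟩

theorem hasCofinalSeq_compactSets_iff [TopologicalSpace X] [Nonempty X] :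
    HasCofinalSeq (compactSets X) ↔ Hemicompact X := by
  constructor
  · rintro ⟨A, hA, hcof⟩
    refine ⟨A, fun n => (hA n).1, fun C hC => ?_⟩
    rcases C.eq_empty_or_nonempty with rfl | hne
    · exact ⟨0, empty_subset _⟩
    · exact hcof C ⟨hC, hne⟩
  · rintro ⟨K, hK, hcof⟩
    let x : X := Classical.arbitrary X
    -- Some `K n` may be empty, which `compactSets` excludes.
    refine ⟨fun n => insert x (K n), fun n => ⟨(hK n).insert x, insert_nonempty _ _⟩,
      fun B hB => ?_⟩
    obtain ⟨n, hn⟩ := hcof B hB.1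
    exact ⟨n, hn.trans (subset_insert _ _)⟩

/-- In the Vietoris topology the union of a compact family of compact sets is compact, and so is the
family of non-empty compact subsets of a compact set; these two operations carry cofinal sequences
across. -/
theorem hemicompact_nonemptyCompacts_iff [TopologicalSpace X] :
    Hemicompact (NonemptyCompacts X) ↔ Hemicompact X := by
  constructor
  · rintro ⟨K, hK, hcof⟩
    refine ⟨fun n => ⋃ L ∈ K n, (L : Set X),
      fun n => NonemptyCompacts.isCompact_biUnion_coe_of_isCompact (hK n), fun C hC => ?_⟩
    rcases C.eq_empty_or_nonempty with rfl | hne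
    · exact ⟨0, empty_subset _⟩
    · obtain ⟨n, hn⟩ := hcof {⟨⟨C, hC⟩, hne⟩} isCompact_singleton
      exact ⟨n, fun x hx => mem_biUnion (hn rfl) hx⟩
  · rintro ⟨K, hK, hcof⟩
    refine ⟨fun n => {L | (L : Set X) ⊆ K n},
      fun n => NonemptyCompacts.isCompact_subsets_of_isCompact (hK n), fun C hC => ?_⟩
    obtain ⟨n, hn⟩ := hcof _ (NonemptyCompacts.isCompact_biUnion_coe_of_isCompact hC)
    exact ⟨n, fun L hL => (subset_biUnion_of_mem (u := fun L : NonemptyCompacts X => (L : Set X))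
      hL).trans hn⟩

end Cofinal

/-! ### Markov strategies in cluster-point and cover games -/

section Games

/-- A smaller family of moves for One is better for Two. -/
theorem TwoMarkovWins.anti_left {α : Type*} {𝒜 𝒜' ℬ : Set (Set α)} (h : TwoMarkovWins 𝒜 ℬ)
    (hle : 𝒜' ⊆ 𝒜) : TwoMarkovWins 𝒜' ℬ := by
  obtain ⟨τ, hτ, hwin⟩ := h
  exact ⟨fun A => τ ⟨A, hle A.2⟩, fun A => hτ ⟨A, hle A.2⟩, fun A => hwin fun n => ⟨A n, hle (A n).2⟩⟩

/-- Two can answer with a sequence that converges to a point with a countable neighbourhood base. -/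
theorem twoMarkovWins_clusterSets {Z : Type*} [TopologicalSpace Z] [FirstCountableTopology Z]
    (z : Z) : TwoMarkovWins (clusterSets z) (clusterSets z) := by
  obtain ⟨B, hB⟩ := (𝓝 z).exists_antitone_basis
  have h : ∀ (A : clusterSets z) (n : ℕ), ∃ x, x ∈ B n ∧ x ∈ (A : Set Z) := fun A n =>
    mem_closure_iff_nhds.mp A.2 _ (hB.mem n)
  choose τ hτB hτA using h
  exact ⟨τ, hτA, fun A => mem_closure_of_tendsto (hB.tendsto fun n => hτB (A n) n)
    (Filter.Eventually.of_forall fun n => mem_range_self n)⟩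

/-- A set which contains none of Two's answers at turn `n` is not a legal move of One. -/
theorem notMem_of_forall_answer_notMem {α : Type*} {𝒜 : Set (Set α)} {τ : 𝒜 → ℕ → α}
    (hτ : ∀ (A : 𝒜) (n : ℕ), τ A n ∈ (A : Set α)) (n : ℕ) {E : Set α}
    (hE : ∀ A, τ A n ∉ E) : E ∉ 𝒜 :=
  fun h => hE ⟨E, h⟩ (hτ ⟨E, h⟩ n)

/-- A winning strategy yields a cofinal sequence because, at each turn, its answers must include all
proper open supersets of some member of `𝒜`. -/
theorem hasCofinalSeq_iff_twoMarkovWins_coversOf {X : Type*} [TopologicalSpace X] [T1Space X]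
    {𝒜 : Set (Set X)} (hne : ∀ A ∈ 𝒜, A.Nonempty) (hfin : finiteSets X ⊆ 𝒜) :
    HasCofinalSeq 𝒜 ↔ TwoMarkovWins (coversOf 𝒜) (coversOf 𝒜) := by
  have hsing : ∀ x, {x} ∈ 𝒜 := fun x => hfin ⟨finite_singleton x, singleton_nonempty x⟩
  have hcover : ∀ 𝒰 : Set (Set X), (∀ A ∈ 𝒜, ∃ U ∈ 𝒰, A ⊆ U) → ⋃₀ 𝒰 = univ := fun 𝒰 h =>
    eq_univ_of_forall fun x => by
      obtain ⟨U, hU, hx⟩ := h {x} (hsing x)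
      exact ⟨U, hU, hx rfl⟩
  constructor
  · rintro ⟨A, hA, hcof⟩
    choose τ hτ hAτ using fun (𝒰 : coversOf 𝒜) (n : ℕ) => 𝒰.2.2.2.2.2 (A n) (hA n)
    refine ⟨τ, hτ, fun 𝒰 => ?_⟩
    have hA' : ∀ B ∈ 𝒜, ∃ U ∈ range fun n => τ (𝒰 n) n, B ⊆ U := fun B hB => by
      obtain ⟨n, hn⟩ := hcof B hB
      exact ⟨_, mem_range_self n, hn.trans (hAτ _ n)⟩
    refine ⟨?_, hcover _ hA', ?_, ?_, hA'⟩
    · rintro _ ⟨n, rfl⟩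
      exact (𝒰 n).2.1 _ (hτ _ n)
    · rintro ⟨n, hn⟩
      exact (𝒰 n).2.2.2.1 (hn ▸ hτ (𝒰 n) n)
    · rintro ⟨n, hn⟩
      exact (𝒰 n).2.2.2.2.1 (hn ▸ hτ (𝒰 n) n)
  · rintro ⟨τ, hτ, hwin⟩
    -- Otherwise the proper non-empty open sets never answered at turn `n` would form a legal move
    -- of One.
    have key : ∀ n, ∃ A ∈ 𝒜, ∀ U : Set X, IsOpen U → U ≠ univ → A ⊆ U → ∃ 𝒰, τ 𝒰 n = U := by
      intro n
      by_contra! hcon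
      have hE : ∀ A ∈ 𝒜, ∃ U ∈ {U : Set X | IsOpen U ∧ U.Nonempty ∧ U ≠ univ ∧ ∀ 𝒰, τ 𝒰 n ≠ U},
          A ⊆ U := fun A hA => by
        obtain ⟨U, hU, hU', hAU, hτU⟩ := hcon A hA
        exact ⟨U, ⟨hU, (hne A hA).mono hAU, hU', hτU⟩, hAU⟩
      exact notMem_of_forall_answer_notMem hτ n (fun 𝒰 h => h.2.2.2 𝒰 rfl)
        ⟨fun U h => h.1, hcover _ hE, fun h => not_nonempty_empty h.2.1, fun h => h.2.2.1 rfl, hE⟩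
    choose A hA hAτ using key
    by_contra hcon
    obtain ⟨C, hC, x, hx⟩ := exists_mem_forall_notMem_of_not_hasCofinalSeq hcon hA
    -- One makes Two answer with the complement of `x n ∈ C`, so no answer contains `C`.
    choose 𝒰 h𝒰 using fun n => hAτ n {x n}ᶜ isOpen_compl_singleton
      (fun h => (h ▸ mem_univ (x n) : x n ∈ ({x n}ᶜ : Set X)) rfl)
      (subset_compl_singleton_iff.mpr (hx n).2)
    obtain ⟨_, ⟨n, rfl⟩, hn⟩ := (hwin 𝒰).2.2.2.2 C hC
    simp only [h𝒰] at hn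
    exact hn (hx n).1 rfl

end Games

/-! ### Discrete selectivity in `T₁` spaces -/

section Topology

variable {Z : Type*} [TopologicalSpace Z]

/-- A sequence in a `T₁` space which is locally finite has closed discrete range. -/
theorem range_mem_closedDiscrete [T1Space Z] {z : ℕ → Z}
    (h : ∀ w, ∃ N ∈ 𝓝 w, {n | z n ∈ N}.Finite) : range z ∈ closedDiscrete Z := by
  refine isClosed_and_discrete_iff.mpr fun w => ?_
  obtain ⟨N, hN, hfin⟩ := h w
  rw [Filter.disjoint_principal_right, mem_nhdsWithin_iff_exists_mem_nhds_inter]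
  refine ⟨N ∩ (z '' {n | z n ∈ N} \ {w})ᶜ, Filter.inter_mem hN
    ((((hfin.image z).subset sdiff_subset).isClosed.isOpen_compl).mem_nhds fun h => h.2 rfl), ?_⟩
  rintro _ ⟨⟨hvN, hv⟩, hvw⟩ ⟨n, rfl⟩
  exact hv ⟨⟨n, hvN, rfl⟩, hvw⟩

/-- A first countable `T₁` space with a non-isolated point is not discretely selective. -/
theorem not_discretelySelective_of_neBot [T1Space Z] [FirstCountableTopology Z] (z : Z)
    [Filter.NeBot (𝓝[≠] z)] : ¬ DiscretelySelective Z := by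
  intro h
  obtain ⟨B, hB⟩ := (nhds_basis_opens z).exists_antitone_subbasis
  -- Any selection from these sets converges to `z` but omits it, so its range is not closed.
  obtain ⟨x, hx, hcl, -⟩ := h (fun n => B n \ {z}) fun n =>
    ⟨(hB.1 n).2.sdiff isClosed_singleton, Filter.nonempty_of_mem (f := 𝓝[≠] z)
      (sdiff_mem_nhdsWithin_compl ((hB.1 n).2.mem_nhds (hB.1 n).1) _),
      fun h => (h ▸ mem_univ z : z ∈ B n \ {z}).2 rfl⟩
  have hz : z ∈ range x := hcl.closure_subset (mem_closure_of_tendsto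
    (hB.2.tendsto fun n => (hx n).1) (Filter.Eventually.of_forall fun n => mem_range_self n))
  obtain ⟨n, hn⟩ := hz
  exact (hx n).2 hn

end Topology

/-! ### Uniform convergence of minimal usco maps on `𝒜` -/

section MU

variable {X : Type*} [TopologicalSpace X] {𝒜 : Set (Set X)}

theorem W_mono {A B : Set X} {ε δ : ℝ} (hAB : A ⊆ B) (h : δ ≤ ε) : W 𝒜 B δ ⊆ W 𝒜 A ε :=
  fun _ hp x hx => ⟨(hp x (hAB hx)).1.trans (Metric.thickening_mono h _),
    (hp x (hAB hx)).2.trans (Metric.thickening_mono h _)⟩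

theorem MU.hasBasis_nhds (h : 𝒜.Nonempty) (h' : DirectedOn (· ⊆ ·) 𝒜) (Φ : MU X 𝒜) :
    (𝓝 Φ).HasBasis (fun p : Set X × ℝ => p.1 ∈ 𝒜 ∧ 0 < p.2)
      (fun p => {Ψ | (Φ, Ψ) ∈ W 𝒜 p.1 p.2}) :=
  nhds_basis_uniformity' (hasBasis_uniformity h h')

theorem MU.t0Space (h : ⋃₀ 𝒜 = univ) : T0Space (MU X 𝒜) := by
  have : T2Space (UniformOnFun X (NonemptyCompacts ℝ) 𝒜) :=
    UniformOnFun.t2Space_of_covering h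
  have hi : Topology.IsInducing fun Φ : MU X 𝒜 => UniformOnFun.ofFun 𝒜 Φ.1 := ⟨rfl⟩
  exact (Topology.IsEmbedding.mk hi fun Φ Ψ hΦ => Subtype.ext hΦ).t0Space

theorem MU.isCountablyGenerated_uniformity (h' : DirectedOn (· ⊆ ·) 𝒜) (h : HasCofinalSeq 𝒜) :
    (𝓤 (MU X 𝒜)).IsCountablyGenerated := by
  obtain ⟨A, hA, hcof⟩ := h
  have hb : (𝓤 (MU X 𝒜)).HasBasis (fun _ : ℕ × ℕ => True)
      (fun p => W 𝒜 (A p.1) (1 / (p.2 + 1))) := by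
    refine (hasBasis_uniformity ⟨A 0, hA 0⟩ h').to_hasBasis ?_ fun p _ =>
      ⟨(A p.1, 1 / (p.2 + 1)), ⟨hA _, by positivity⟩, Subset.rfl⟩
    rintro ⟨B, ε⟩ ⟨hB, hε⟩
    obtain ⟨n, hn⟩ := hcof B hB
    obtain ⟨m, hm⟩ := exists_nat_one_div_lt hε
    exact ⟨(n, m), trivial, W_mono hn hm.le⟩
  exact hb.isCountablyGenerated

/-- The constant maps `{r}` with `r ≠ 0` converge to `0` as `r → 0`. -/
theorem MU.neBot_nhdsNE_zero [Nonempty X] (h : 𝒜.Nonempty) (h' : DirectedOn (· ⊆ ·) 𝒜) :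
    Filter.NeBot (𝓝[≠] (0 : MU X 𝒜)) := by
  let f : ℝ → MU X 𝒜 := fun r => ⟨fun _ => {r}, isMinimalUsco_const_singleton r⟩
  have hf : Filter.Tendsto f (𝓝 0) (𝓝 0) := by
    refine (MU.hasBasis_nhds h h' 0).tendsto_right_iff.mpr fun p hp => ?_
    filter_upwards [Metric.ball_mem_nhds (0 : ℝ) hp.2] with r hr x _
    have h0 : (0 : MU X 𝒜).1 x = {0} := rfl
    have hr' : dist r 0 < p.2 := hr
    simp [f, h0, dist_comm] at hr' ⊢
    exact hr'
  have hinj : ∀ r ≠ 0, f r ≠ 0 := fun r hr h => hr <| by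
    have := congrFun (congrArg Subtype.val h) (Classical.arbitrary X)
    exact NonemptyCompacts.singleton_injective this
  have : Filter.Tendsto f (𝓝[≠] 0) (𝓝[≠] 0) :=
    tendsto_nhdsWithin_iff.mpr ⟨hf.mono_left nhdsWithin_le_nhds,
      eventually_nhdsWithin_of_forall hinj⟩
  exact this.neBot

/-- Inside a basic neighbourhood given by `A`, the value at a point off `A` is arbitrary. -/
theorem MU.exists_mem_W_apply_eq [T3Space X] (hcpt : 𝒜 ⊆ compactSets X) (Φ : MU X 𝒜) {A : Set X}
    (hA : A ∈ 𝒜) {ε : ℝ} (hε : 0 < ε) {x : X} (hx : x ∉ A) (r : ℝ) :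
    ∃ Ψ : MU X 𝒜, (Φ, Ψ) ∈ W 𝒜 A ε ∧ Ψ.1 x = {r} := by
  obtain ⟨Ψ, hΨ, heq, hr⟩ := Φ.2.exists_eqOn_apply_eq (hcpt hA).1 hx r
  refine ⟨⟨Ψ, hΨ⟩, fun y hy => ?_, hr⟩
  simp only [heq hy]
  exact ⟨Metric.self_subset_thickening hε _, Metric.self_subset_thickening hε _⟩

/-- If `𝒜` has no cofinal sequence and `Uₙ` are non-empty open sets, then for any `rₙ` there are
`Φₙ ∈ Uₙ` which take the values `{rₙ}` at points of one member of `𝒜`. -/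
theorem MU.exists_mem_forall_apply_eq [T3Space X] [Nonempty X] (hfin : finiteSets X ⊆ 𝒜)
    (hcpt : 𝒜 ⊆ compactSets X) (hdir : DirectedOn (· ⊆ ·) 𝒜)
    (h : ¬ HasCofinalSeq 𝒜) {U : ℕ → Set (MU X 𝒜)}
    (hU : ∀ n, IsOpen (U n)) (hne : ∀ n, (U n).Nonempty) (r : ℕ → ℝ) :
    ∃ C ∈ 𝒜, ∃ Φ : ℕ → MU X 𝒜, ∀ n, Φ n ∈ U n ∧ ∃ x ∈ C, (Φ n).1 x = {r n} := by
  have hA : 𝒜.Nonempty := ⟨{Classical.arbitrary X}, hfin ⟨finite_singleton _, singleton_nonempty _⟩⟩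
  choose Φ hΦ using hne
  choose p hp hpU using fun n =>
    (MU.hasBasis_nhds hA hdir (Φ n)).mem_iff.mp ((hU n).mem_nhds (hΦ n))
  obtain ⟨C, hC, x, hx⟩ := exists_mem_forall_notMem_of_not_hasCofinalSeq h fun n => (hp n).1
  choose Ψ hΨ hr using fun n => MU.exists_mem_W_apply_eq hcpt (Φ n) (hp n).1 (hp n).2 (hx n).2 (r n)
  exact ⟨C, hC, Ψ, fun n => ⟨hpU n (hΨ n), x n, (hx n).1, hr n⟩⟩

/-- The equivalences for uniform convergence on a directed family of compact sets which contains
all finite sets. -/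
theorem MU.tfae [T3Space X] [Nonempty X] (hfin : finiteSets X ⊆ 𝒜)
    (hcpt : 𝒜 ⊆ compactSets X) (hdir : DirectedOn (· ⊆ ·) 𝒜) :
    [ HasCofinalSeq 𝒜,
      MetrizableSpace (MU X 𝒜),
      ¬ DiscretelySelective (MU X 𝒜),
      TwoMarkovWins (coversOf 𝒜) (coversOf 𝒜),
      TwoMarkovWins (clusterSets (0 : MU X 𝒜)) (clusterSets (0 : MU X 𝒜)),
      TwoMarkovWins (denseSets (MU X 𝒜)) (clusterSets (0 : MU X 𝒜)) ].TFAE := by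
  have hsing : ∀ x, {x} ∈ 𝒜 := fun x => hfin ⟨finite_singleton x, singleton_nonempty x⟩
  have hA : 𝒜.Nonempty := ⟨_, hsing (Classical.arbitrary X)⟩
  have hT0 : T0Space (MU X 𝒜) := MU.t0Space (eq_univ_of_forall fun x => ⟨_, hsing x, rfl⟩)
  tfae_have 1 → 2 := fun h => by
    have := MU.isCountablyGenerated_uniformity hdir h
    exact UniformSpace.metrizableSpace
  tfae_have 2 → 3 := fun _ =>
    have := MU.neBot_nhdsNE_zero hA hdir
    not_discretelySelective_of_neBot 0
  tfae_have 3 → 1 := fun h => by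
    by_contra hcon
    refine h fun U hU => ?_
    obtain ⟨C, hC, Φ, hΦ⟩ := MU.exists_mem_forall_apply_eq hfin hcpt hdir hcon
      (fun n => (hU n).1) (fun n => (hU n).2.1) fun n => n
    refine ⟨Φ, fun n => (hΦ n).1, range_mem_closedDiscrete fun Ψ => ?_⟩
    -- As `Ψ` is bounded by `k` on `C`, a map within distance `1` of it on `C` cannot take the value
    -- `{n}` there once `n ≥ k + 1`; the sequence is therefore locally finite.
    obtain ⟨k, hk⟩ := Ψ.2.1.exists_forall_subset_ball (hcpt hC).1
    refine ⟨_, (MU.hasBasis_nhds hA hdir Ψ).mem_of_mem (i := (C, 1)) ⟨hC, one_pos⟩,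
      (finite_Iio (k + 1)).subset fun n hn => ?_⟩
    obtain ⟨x, hx, hr⟩ := (hΦ n).2
    have h1 := (hn x hx).2
    simp only [hr, NonemptyCompacts.coe_singleton, singleton_subset_iff,
      Metric.mem_thickening_iff] at h1
    obtain ⟨y, hy, hny⟩ := h1
    have h2 := hk x hx hy
    rw [mem_ball_zero_iff, Real.norm_eq_abs] at h2
    rw [Real.dist_eq] at hny
    have : (n : ℝ) < k + 1 := by linarith [abs_lt.mp h2, abs_lt.mp hny]
    exact_mod_cast this
  tfae_have 1 ↔ 4 := hasCofinalSeq_iff_twoMarkovWins_coversOf (fun A hA => (hcpt hA).2) hfin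
  tfae_have 2 → 5 := fun _ => twoMarkovWins_clusterSets 0
  tfae_have 5 → 6 := fun h => h.anti_left fun D hD => hD 0
  tfae_have 6 → 1 := fun ⟨τ, hτ, hwin⟩ => by
    by_contra hcon
    -- The maps never answered at turn `n` cannot form a dense set, which One could play; so the
    -- answers have non-empty interior.
    have key : ∀ n, ∃ U : Set (MU X 𝒜), IsOpen U ∧ U.Nonempty ∧ ∀ Φ ∈ U, ∃ D, τ D n = Φ := by
      intro n
      have hE : ¬ Dense (range fun D => τ D n)ᶜ :=
        notMem_of_forall_answer_notMem hτ n fun D h => h ⟨D, rfl⟩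
      rw [← interior_eq_empty_iff_dense_compl, ← Ne, ← nonempty_iff_ne_empty] at hE
      exact ⟨_, isOpen_interior, hE, fun Φ hΦ => mem_range.mp (interior_subset hΦ)⟩
    choose U hU hne hUτ using key
    obtain ⟨C, hC, Φ, hΦ⟩ := MU.exists_mem_forall_apply_eq hfin hcpt hdir hcon hU hne fun _ => 1
    choose D hD using fun n => hUτ n _ (hΦ n).1
    have h0 := hwin D
    simp only [hD] at h0
    obtain ⟨_, hn, n, rfl⟩ := mem_closure_iff_nhds.mp h0 _
      ((MU.hasBasis_nhds hA hdir 0).mem_of_mem (i := (C, 1)) ⟨hC, one_pos⟩)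
    obtain ⟨x, hx, hr⟩ := (hΦ n).2
    have h1 := (hn x hx).2
    have h2 : (0 : MU X 𝒜).1 x = {0} := rfl
    -- The thickening is open, so `1` is not within `1` of `0`.
    simp [hr, h2] at h1
  tfae_finish

end MU

end MinimalUsco

open MinimalUsco

theorem corollary3p10 {X : Type*} [TopologicalSpace X] [T3Space X] [Nonempty X] :
    [ Countable X,
      MetrizableSpace (MUp X),
      ¬ DiscretelySelective (MUp X),
      TwoMarkovWins (omegaCovers X) (omegaCovers X),
      TwoMarkovWins (clusterSets (0 : MUp X)) (clusterSets (0 : MUp X)),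
      TwoMarkovWins (denseSets (MUp X)) (clusterSets (0 : MUp X)) ].TFAE ∧
    [ Hemicompact X,
      Hemicompact (NonemptyCompacts X),
      MetrizableSpace (MUk X),
      ¬ DiscretelySelective (MUk X),
      TwoMarkovWins (kCovers X) (kCovers X),
      TwoMarkovWins (clusterSets (0 : MUk X)) (clusterSets (0 : MUk X)),
      TwoMarkovWins (denseSets (MUk X)) (clusterSets (0 : MUk X)) ].TFAE := by
  have hfc : finiteSets X ⊆ compactSets X := fun A hA => ⟨hA.1.isCompact, hA.2⟩
  constructor
  · rw [← hasCofinalSeq_finiteSets_iff]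
    exact MU.tfae Subset.rfl hfc fun A hA B hB =>
      ⟨A ∪ B, ⟨hA.1.union hB.1, hA.2.inl⟩, subset_union_left, subset_union_right⟩
  · have h := MU.tfae hfc Subset.rfl fun A hA B hB =>
      ⟨A ∪ B, ⟨hA.1.union hB.1, hA.2.inl⟩, subset_union_left, subset_union_right⟩
    rw [hasCofinalSeq_compactSets_iff] at h
    exact List.tfae_cons_cons.mpr ⟨hemicompact_nonemptyCompacts_iff.symm, by
      rw [hemicompact_nonemptyCompacts_iff]; exact h⟩
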